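/- Let $n\ge 1$, let $I=\{1,\dots,2n-1\}$ be the vertex set of the Dynkin graph of type $A_{2n-1}$ ($i,j$ adjacent iff $|i-j|=1$), let $H$ be its set of oriented edges $h:\mathrm{out}(h)\to\mathrm{inc}(h)$, with $\bar h$ the reversed edge. Let $\Omega\subset H$ be an orientation ($\Omega\cup\bar\Omega=H$, $\Omega\cap\bar\Omega=\emptyset$), and let $\varepsilon(h)=1$ for $h\in\Omega$, $\varepsilon(h)=-1$ for $h\in\bar\Omega$. For $\mathbf v,\mathbf w\in(\mathbb Z_{\ge0})^I$ put $V_i=\mathbb C^{\mathbf v_i}$, $W_i=\mathbb C^{\mathbf w_i}$. Let $\Lambda(\mathbf v;\mathbf w)^{\mathrm{st}}$ be the set of all $(x,t)$, where $x=(x_h)\in\bigoplus_{h\in H}\mathrm{Hom}(V_{\mathrm{out}(h)},V_{\mathrm{inc}(h)})$ and $t=(t_i)\in\bigoplus_i\mathrm{Hom}(V_i,W_i)$, such that * $\sum_{\mathrm{inc}(h)=i}\varepsilon(h)x_hx_{\bar h}=0$ for all $i\in I$; * $x$ is nilpotent: for some $N\ge1$, all compositions of $N$ consecutive maps $x_h$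 vanish; * (stability) every $I$-graded subspace $S\subset V$ with $x(S)\subset S$ and $t(S)=0$ is zero. Let $\mathcal L(\mathbf v,\mathbf w)=\Lambda(\mathbf v;\mathbf w)^{\mathrm{st}}/\prod_i GL(V_i)$, with the quotient of the Zariski topology, where $g\cdot(x,t)=((g_{\mathrm{inc}(h)}x_hg_{\mathrm{out}(h)}^{-1}),(t_ig_i^{-1}))$. Let $B(\mathbf w)=\bigsqcup_{\mathbf v}\{\text{irreducible components of }\mathcal L(\mathbf v,\mathbf w)\}$, and let $\mathbf w=\mathbf e^n$ be the vector with $n$th component $1$ and all other components $0$. Let $\mathcal Y$ be the set of Young diagrams that fit inside an $n\times n$ box. The cell of $Y\in\mathcal Y$ in row $r$ and column $s$ (counted from $0$) has degree $n+s-r\in I$. Let $\mathbf v_Y\in(\mathbb Z_{\ge0})^I$ be the vector whose $k$th component is the number of cells of $Y$ of degree $k$, and let $X_Y\subset\mathcal L(\mathbf v_Y,\mathbf e^n)$ be the set of all $[x,t]$ such that the spaces $V_k$ have bases $(b_c)$, indexed by the cells $c$ of $Y$ of degree $k$, with the following properties. For $h:k\to k-1$, $x_h$ maps $b_c$ to $b_{c'}$,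 where $c'$ is the left neighbour of $c$, and to $0$ if there is none. For $h:k\to k+1$, $x_h$ maps $b_c$ to $\varepsilon(h)b_{c'}$, where $c'$ is the upper neighbour of $c$, and to $0$ if there is none. Finally, $t$ maps $b_{(0,0)}$ to $1\in W_n=\mathbb C$ (if $Y\neq\emptyset$) and all other $b_c$ to $0$. Then $Y\mapsto X_Y$ is a bijection from $\mathcal Y$ onto $B(\mathbf e^n)$ (in particular, each $X_Y$ is an irreducible component of $\mathcal L(\mathbf v_Y,\mathbf e^n)$). Furthermore, every irreducible component in $B(\mathbf e^n)$ is a single point. -/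

import Mathlib

namespace QuiverVariety

/-! ### Nakajima's quiver varieties attached to a finite simple graph

The oriented edges `h` are the darts of `G`: `h.fst` is the outgoing vertex `out h`, `h.snd` is the
incoming vertex `inc h`, and `h.symm` is the reversed edge. -/

section General

variable {I : Type} (G : SimpleGraph I)

/-- The standard space `ℂ^d`. -/
abbrev Sp (d : ℕ) : Type := Fin d → ℂ

/-- An orientation: a set `Ω` of oriented edges such that `Ω ∪ Ω̄ = H` and `Ω ∩ Ω̄ = ∅`. -/
def IsOrientation (Ω : Set G.Dart) : Prop :=
  Ω ∪ SimpleGraph.Dart.symm '' Ω = Set.univ ∧ Ω ∩ SimpleGraph.Dart.symm '' Ω = ∅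

variable {G}

open Classical in
/-- The sign `ε(h)`: `1` on `Ω` and `-1` on its complement. -/
noncomputable def sgn (Ω : Set G.Dart) (h : G.Dart) : ℂ := if h ∈ Ω then 1 else -1

variable (G)

/-- `E(v) = ⨁_h Hom(V_{out h}, V_{inc h})` with `V_i = ℂ^{v_i}`. -/
abbrev EE (v : I → ℕ) : Type := (h : G.Dart) → (Sp (v h.fst) →ₗ[ℂ] Sp (v h.snd))

/-- The ambient space `E(v) ⊕ ⨁_i Hom(V_i, W_i)` of pairs `(x, t)`, with `W_i = ℂ^{w_i}`. -/
abbrev Pair (v w : I → ℕ) : Type := EE G v × ((i : I) → (Sp (v i) →ₗ[ℂ] Sp (w i)))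

variable {G}

open Classical in
/-- The component `ψ_i(x) = ∑_{inc h = i} ε(h) x_h x_{h̄}` of the moment map; the oriented edges
with `inc h = i` are the `j → i` with `j` adjacent to `i`. -/
noncomputable def moment [Fintype I] (Ω : Set G.Dart) {v : I → ℕ} (x : EE G v) (i : I) :
    Sp (v i) →ₗ[ℂ] Sp (v i) :=
  ∑ j : I, if hji : G.Adj j i then
    sgn Ω ⟨(j, i), hji⟩ • ((x ⟨(j, i), hji⟩) ∘ₗ (x ⟨(i, j), hji.symm⟩)) else 0

/-- The composition of the `x_h` along a walk. -/
def walkMap {v : I → ℕ} (x : EE G v) : {i j : I} → G.Walk i j → (Sp (v i) →ₗ[ℂ] Sp (v j))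
  | _, _, SimpleGraph.Walk.nil => LinearMap.id
  | i, _, SimpleGraph.Walk.cons (v := k) h p => (walkMap x p) ∘ₗ (x ⟨(i, k), h⟩)

/-- `x` is nilpotent: for some `N ≥ 1` all compositions along `N` consecutive edges vanish. -/
def IsNilp {v : I → ℕ} (x : EE G v) : Prop :=
  ∃ N : ℕ, 1 ≤ N ∧ ∀ (i j : I) (p : G.Walk i j), p.length = N → walkMap x p = 0

/-- Lusztig's quiver variety `Λ(v)`. -/
def LambdaV [Fintype I] (Ω : Set G.Dart) (v : I → ℕ) : Set (EE G v) :=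
  {x | (∀ i, moment Ω x i = 0) ∧ IsNilp x}

/-- Stability of `(x, t)`: every graded `x`-stable subspace on which `t` vanishes is zero. -/
def IsStab {v w : I → ℕ} (z : Pair G v w) : Prop :=
  ∀ S : (i : I) → Submodule ℂ (Sp (v i)),
    (∀ h : G.Dart, ∀ a ∈ S h.fst, z.1 h a ∈ S h.snd) →
    (∀ i, ∀ a ∈ S i, z.2 i a = 0) → ∀ i, S i = ⊥

/-- `Λ(v; w)^st`. -/
def LambdaSt [Fintype I] (Ω : Set G.Dart) (v w : I → ℕ) : Set (Pair G v w) :=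
  {z | z.1 ∈ LambdaV Ω v ∧ IsStab z}

/-- The action of `G_v = ∏_i GL(V_i)`: `x_h ↦ g_{inc h} x_h g_{out h}⁻¹`, `t_i ↦ t_i g_i⁻¹`. -/
def act {v w : I → ℕ} (g : (i : I) → (Sp (v i) ≃ₗ[ℂ] Sp (v i))) (z : Pair G v w) : Pair G v w :=
  (fun h => (g h.snd).toLinearMap ∘ₗ (z.1 h) ∘ₗ (g h.fst).symm.toLinearMap,
   fun i => (z.2 i) ∘ₗ (g i).symm.toLinearMap)

/-- Being in the same `G_v`-orbit. -/
def orbitSetoid [Fintype I] (Ω : Set G.Dart) (v w : I → ℕ) : Setoid (LambdaSt Ω v w) where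
  r z z' := ∃ g : (i : I) → (Sp (v i) ≃ₗ[ℂ] Sp (v i)), act g z.1 = z'.1
  iseqv := by
    refine ⟨fun z => ⟨fun i => LinearEquiv.refl ℂ _, ?_⟩, ?_, ?_⟩
    · rfl
    · rintro z z' ⟨g, hg⟩
      refine ⟨fun i => (g i).symm, ?_⟩
      rw [← hg]
      refine Prod.ext ?_ ?_
      · funext h; refine LinearMap.ext fun a => ?_; simp [act]
      · funext i; refine LinearMap.ext fun a => ?_; simp [act]
    · rintro z z' z'' ⟨g, hg⟩ ⟨g', hg'⟩
      refine ⟨fun i => (g i).trans (g' i), ?_⟩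
      rw [← hg', ← hg]
      rfl

/-- The Zariski topology on a finite-dimensional complex vector space: the polynomial functions
are the algebra generated by the linear forms, and the non-vanishing loci of polynomial functions
are a basis of open sets. -/
abbrev zariski (M : Type) [AddCommGroup M] [Module ℂ M] : TopologicalSpace M :=
  TopologicalSpace.generateFrom
    {U | ∃ f ∈ Algebra.adjoin ℂ (Set.range fun φ : Module.Dual ℂ M => (φ : M → ℂ)),
      U = {a | f a ≠ 0}}

/-- Nakajima's quiver variety `𝓛(v, w) = Λ(v; w)^st / G_v` (its set of points). -/
def LL [Fintype I] (Ω : Set G.Dart) (v w : I → ℕ) : Type := Quotient (orbitSetoid Ω v w)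

/-- The orbit `[x, t]`. -/
def orbitOf [Fintype I] (Ω : Set G.Dart) {v w : I → ℕ} (z : LambdaSt Ω v w) : LL Ω v w :=
  Quotient.mk (orbitSetoid Ω v w) z

/-- The Zariski topology of the geometric quotient `𝓛(v, w)`: the quotient topology of the
subspace topology on `Λ(v; w)^st`. -/
instance LL.topology [Fintype I] (Ω : Set G.Dart) (v w : I → ℕ) : TopologicalSpace (LL Ω v w) :=
  TopologicalSpace.coinduced (orbitOf Ω)
    (TopologicalSpace.induced Subtype.val (zariski (Pair G v w)))

/-- `B(w) = ⨆_v B(v, w)`, the disjoint union over all `v` of the sets of irreducible components of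
`𝓛(v, w)`. -/
def BB [Fintype I] (Ω : Set G.Dart) (w : I → ℕ) : Set (Σ v : I → ℕ, Set (LL Ω v w)) :=
  {p | p.2 ∈ irreducibleComponents (LL Ω p.1 w)}

end General

/-! ### Type `A_{2n-1}`: the vertex `k ∈ {1, …, 2n-1}` is the element `k - 1` of `Fin (2n-1)`. -/

/-- The Dynkin graph of type `A_{2n-1}`. -/
abbrev dynkinA (n : ℕ) : SimpleGraph (Fin (2 * n - 1)) := SimpleGraph.pathGraph (2 * n - 1)

/-- `e^n`: the `n`th component is one, all the others are zero. -/
def eVec (n : ℕ) : Fin (2 * n - 1) → ℕ := fun k => if (k : ℕ) + 1 = n then 1 else 0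

/-- The Young diagrams that fit inside an `n × n` box. -/
def boxDiagrams (n : ℕ) : Set YoungDiagram := {Y | ∀ c ∈ Y, c.1 < n ∧ c.2 < n}

/-- The cells `(r, s)` (row `r`, column `s`, counted from `0`) of `Y` of degree `n + s - r = k`. -/
def cellsOfDegree (n : ℕ) (Y : YoungDiagram) (k : Fin (2 * n - 1)) : Finset (ℕ × ℕ) :=
  Y.cells.filter fun c => n + c.2 = ((k : ℕ) + 1) + c.1

/-- The graded dimension attached to `Y`: the number of cells of each degree. -/
def dimY (n : ℕ) (Y : YoungDiagram) : Fin (2 * n - 1) → ℕ := fun k => (cellsOfDegree n Y k).card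

/-- The basis vector `b_c` of `V_k` attached to the cell `c`; zero if `c` is not a cell of `Y` of
degree `k`. -/
noncomputable def cellVec {n : ℕ} {Y : YoungDiagram} {v : Fin (2 * n - 1) → ℕ}
    (b : (k : Fin (2 * n - 1)) → Module.Basis (cellsOfDegree n Y k) ℂ (Sp (v k)))
    (k : Fin (2 * n - 1)) (c : ℕ × ℕ) : Sp (v k) :=
  if hc : c ∈ cellsOfDegree n Y k then b k ⟨c, hc⟩ else 0

/-- `(x, t)` is given by the diagram `Y` in the graded basis `b` indexed by the cells of `Y`: `x`
moves every cell to its upper neighbour (which raises the degree by one) and to its left neighbour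
(which lowers the degree by one), or to zero if there is no such neighbour, and `t` maps the corner
cell to the generator of `W_n = ℂ` and the other cells to zero. The sign `ε(h)` on the upward moves
makes the two ways around a square cancel in the moment map; the choice of signs that does this is
unique up to rescaling of the basis. -/
structure IsDiagramPoint {n : ℕ} (Ω : Set (dynkinA n).Dart) (Y : YoungDiagram)
    {v : Fin (2 * n - 1) → ℕ} (z : Pair (dynkinA n) v (eVec n))
    (b : (k : Fin (2 * n - 1)) → Module.Basis (cellsOfDegree n Y k) ℂ (Sp (v k))) : Prop where
  up : ∀ h : (dynkinA n).Dart, (h.snd : ℕ) = h.fst + 1 →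
    ∀ r s, (r + 1, s) ∈ cellsOfDegree n Y h.fst →
      z.1 h (cellVec b h.fst (r + 1, s)) = sgn Ω h • cellVec b h.snd (r, s)
  up_zero : ∀ h : (dynkinA n).Dart, (h.snd : ℕ) = h.fst + 1 →
    ∀ s, z.1 h (cellVec b h.fst (0, s)) = 0
  left : ∀ h : (dynkinA n).Dart, (h.fst : ℕ) = h.snd + 1 →
    ∀ r s, (r, s + 1) ∈ cellsOfDegree n Y h.fst →
      z.1 h (cellVec b h.fst (r, s + 1)) = cellVec b h.snd (r, s)
  left_zero : ∀ h : (dynkinA n).Dart, (h.fst : ℕ) = h.snd + 1 →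
    ∀ r, z.1 h (cellVec b h.fst (r, 0)) = 0
  corner : ∀ k, (0, 0) ∈ cellsOfDegree n Y k → z.2 k (cellVec b k (0, 0)) = fun _ => 1
  not_corner : ∀ k c, c ≠ (0, 0) → z.2 k (cellVec b k c) = 0

/-- `X_Y ⊆ 𝓛(v_Y, e^n)`: the points `[x, t]` that are given by the diagram `Y` in some basis. -/
def XX {n : ℕ} (Ω : Set (dynkinA n).Dart) (Y : YoungDiagram) : Set (LL Ω (dimY n Y) (eVec n)) :=
  {p | ∃ (z : LambdaSt Ω (dimY n Y) (eVec n)), orbitOf Ω z = p ∧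
    ∃ b : (k : Fin (2 * n - 1)) → Module.Basis (cellsOfDegree n Y k) ℂ (Sp (dimY n Y k)),
      IsDiagramPoint Ω Y z.1 b}

end QuiverVariety

/-! Let R be the sum of the ε(h) x_h over the edges k → k + 1 and L the sum of the x_h over the
edges k → k - 1, acting on V = ⨁ V_k. The moment map is the commutator of R and L
(`commute_raise_lower`), so V is a graded module over the polynomial ring ℂ[R, L], and t is one
linear form, supported at the middle vertex n. Stability says that the forms t L^s R^r separate
points (`eq_zero_of_cellForm`), that is, the dual of V is cyclic: it is ℂ[R, L]/J, with J
homogeneous for deg R = 1, deg L = -1.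

A homogeneous polynomial is a monomial times a polynomial in u = LR. Since the graph is finite, u is
nilpotent on the dual, so a polynomial in u with lowest term u^i is u^i up to a unit. Hence J is a
monomial ideal (`cellCoords_surjective`). The monomials outside J form a Young diagram, inside the n
× n box because only n - 1 steps separate the vertex n from either end. In the dual basis the point
has the required shape (`isDiagramPoint_cellBasis`).

The lengths of its diagonals determine a diagram in the box (`dimY_injOn`), and points with the same
diagram are conjugate, so each quotient has at most one point (`subsingleton_LL`). Conversely, every
diagram in the box gives a stable point (`IsDiagramPoint.mem_lambdaSt`). In a space with at most one
point the irreducible components are the nonempty subsets. -/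

namespace QuiverVariety

/-! ### Signs of an orientation. -/

section Signs

variable {I : Type} {G : SimpleGraph I} {Ω : Set G.Dart}

theorem sgn_mul_self (Ω : Set G.Dart) (h : G.Dart) : sgn Ω h * sgn Ω h = 1 := by
  unfold sgn; split_ifs <;> norm_num

theorem sgn_smul_smul {M : Type*} [AddCommGroup M] [Module ℂ M] (Ω : Set G.Dart) (h : G.Dart)
    (a : M) : sgn Ω h • sgn Ω h • a = a := by
  rw [smul_smul, sgn_mul_self, one_smul]

theorem sgn_symm (hΩ : IsOrientation G Ω) (h : G.Dart) : sgn Ω h.symm = -sgn Ω h := by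
  obtain ⟨h1, h2⟩ := hΩ
  have hu : h ∈ Ω ∨ h.symm ∈ Ω := by
    have : h ∈ Ω ∪ SimpleGraph.Dart.symm '' Ω := by rw [h1]; trivial
    rcases this with h' | ⟨k, hk, rfl⟩
    · exact Or.inl h'
    · right; simpa using hk
  have hn : ¬ (h ∈ Ω ∧ h.symm ∈ Ω) := by
    rintro ⟨ha, hb⟩
    have : h ∈ Ω ∩ SimpleGraph.Dart.symm '' Ω := ⟨ha, h.symm, hb, by simp⟩
    rw [h2] at this
    exact this
  unfold sgn
  by_cases ha : h ∈ Ω <;> by_cases hb : h.symm ∈ Ω <;> simp_all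

end Signs

/-! ### Raising and lowering operators on the total space. -/

variable {n : ℕ} {v : Fin (2 * n - 1) → ℕ} {Ω : Set (dynkinA n).Dart}

theorem dart_cases (h : (dynkinA n).Dart) :
    (h.snd : ℕ) = h.fst + 1 ∨ (h.fst : ℕ) = h.snd + 1 := by
  have := SimpleGraph.pathGraph_adj.1 h.adj
  omega

/-- The total space `⨁ V_k`. -/
abbrev Tot (v : Fin (2 * n - 1) → ℕ) : Type := (k : Fin (2 * n - 1)) → Sp (v k)

open Classical in
/-- The sum of the maps `ε(h) x_h` over the edges `h : k → k + 1`. -/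
noncomputable def raise (Ω : Set (dynkinA n).Dart) (x : EE (dynkinA n) v) : Module.End ℂ (Tot v) :=
  LinearMap.pi fun i => ∑ j, if h : (dynkinA n).Adj j i ∧ (i : ℕ) = j + 1 then
    sgn Ω ⟨(j, i), h.1⟩ • (x ⟨(j, i), h.1⟩ ∘ₗ LinearMap.proj j) else 0

open Classical in
/-- The sum of the maps `x_h` over the edges `h : k → k - 1`. -/
noncomputable def lower (x : EE (dynkinA n) v) : Module.End ℂ (Tot v) :=
  LinearMap.pi fun i => ∑ j, if h : (dynkinA n).Adj j i ∧ (j : ℕ) = i + 1 then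
    x ⟨(j, i), h.1⟩ ∘ₗ LinearMap.proj j else 0

/-- Vectors of the total space that are concentrated in one degree. -/
def IsHomog (d : ℤ) (y : Tot v) : Prop :=
  ∀ i : Fin (2 * n - 1), ((i : ℕ) : ℤ) ≠ d → y i = 0

theorem isHomog_single (k : Fin (2 * n - 1)) (a : Sp (v k)) :
    IsHomog ((k : ℕ) : ℤ) (Pi.single k a : Tot v) := by
  intro i hi
  exact Pi.single_eq_of_ne (by rintro rfl; exact hi rfl) _

theorem raise_apply (x : EE (dynkinA n) v) (h : (dynkinA n).Dart)
    (hd : (h.snd : ℕ) = h.fst + 1) (y : Tot v) :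
    raise Ω x y h.snd = sgn Ω h • x h (y h.fst) := by
  obtain ⟨⟨j, i⟩, hji⟩ := h
  simp only [raise, LinearMap.pi_apply, LinearMap.sum_apply]
  rw [Finset.sum_eq_single j]
  · rw [dif_pos ⟨hji, hd⟩]; rfl
  · intro k _ hk
    rw [dif_neg, LinearMap.zero_apply]
    rintro ⟨_, h2⟩
    exact hk (Fin.ext (by simp only at hd h2; omega))
  · simp

theorem lower_apply (x : EE (dynkinA n) v) (h : (dynkinA n).Dart)
    (hd : (h.fst : ℕ) = h.snd + 1) (y : Tot v) :
    lower x y h.snd = x h (y h.fst) := by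
  obtain ⟨⟨j, i⟩, hji⟩ := h
  simp only [lower, LinearMap.pi_apply, LinearMap.sum_apply]
  rw [Finset.sum_eq_single j]
  · rw [dif_pos ⟨hji, hd⟩]; rfl
  · intro k _ hk
    rw [dif_neg, LinearMap.zero_apply]
    rintro ⟨_, h2⟩
    exact hk (Fin.ext (by simp only at hd h2; omega))
  · simp

/-- Degrees are integers so that a shift may leave the graph; the vector is then zero. -/
theorem IsHomog.raise {x : EE (dynkinA n) v} {d : ℤ} {y : Tot v} (hy : IsHomog d y) :
    IsHomog (d + 1) (raise Ω x y) := by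
  intro i hi
  simp only [QuiverVariety.raise, LinearMap.pi_apply, LinearMap.sum_apply]
  refine Finset.sum_eq_zero fun j _ => ?_
  split_ifs with h
  · have := hy j (by have := h.2; omega)
    simp [this]
  · rfl

theorem IsHomog.lower {x : EE (dynkinA n) v} {d : ℤ} {y : Tot v} (hy : IsHomog d y) :
    IsHomog (d - 1) (lower x y) := by
  intro i hi
  simp only [QuiverVariety.lower, LinearMap.pi_apply, LinearMap.sum_apply]
  refine Finset.sum_eq_zero fun j _ => ?_
  split_ifs with h
  · have := hy j (by have := h.2; omega)
    simp [this]
  · rfl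

theorem raise_single (x : EE (dynkinA n) v) (h : (dynkinA n).Dart)
    (hd : (h.snd : ℕ) = h.fst + 1) (a : Sp (v h.fst)) :
    raise Ω x (Pi.single h.fst a) = Pi.single h.snd (sgn Ω h • x h a) := by
  funext i
  by_cases hi : i = h.snd
  · subst hi
    rw [raise_apply x h hd]; simp
  · rw [Pi.single_eq_of_ne hi]
    refine (isHomog_single _ a).raise i fun h' => hi (Fin.ext ?_)
    omega

theorem lower_single (x : EE (dynkinA n) v) (h : (dynkinA n).Dart)
    (hd : (h.fst : ℕ) = h.snd + 1) (a : Sp (v h.fst)) :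
    lower x (Pi.single h.fst a) = Pi.single h.snd (x h a) := by
  funext i
  by_cases hi : i = h.snd
  · subst hi
    rw [lower_apply x h hd]; simp
  · rw [Pi.single_eq_of_ne hi]
    refine (isHomog_single _ a).lower i fun h' => hi (Fin.ext ?_)
    omega

/-- The moment map is the commutator of the raising and the lowering operator. -/
theorem moment_apply (hΩ : IsOrientation (dynkinA n) Ω) (x : EE (dynkinA n) v)
    (i : Fin (2 * n - 1)) (y : Tot v) :
    moment Ω x i (y i) = (raise Ω x (lower x y) - lower x (raise Ω x y)) i := by
  rw [Pi.sub_apply]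
  conv_rhs =>
    arg 1
    simp only [raise, LinearMap.pi_apply, LinearMap.sum_apply]
  conv_rhs =>
    arg 2
    rw [lower]
    simp only [LinearMap.pi_apply, LinearMap.sum_apply]
  rw [← Finset.sum_sub_distrib, moment, LinearMap.sum_apply]
  refine Finset.sum_congr rfl fun j _ => ?_
  by_cases hji : (dynkinA n).Adj j i
  · rw [dif_pos hji]
    rcases dart_cases ⟨(j, i), hji⟩ with hd | hd <;> simp only at hd
    · rw [dif_pos ⟨hji, hd⟩, dif_neg (by omega)]
      have := lower_apply x ⟨(i, j), hji.symm⟩ hd y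
      simp only at this
      simp [this]
    · rw [dif_neg (by omega), dif_pos ⟨hji, hd⟩]
      have := raise_apply (Ω := Ω) x ⟨(i, j), hji.symm⟩ hd y
      -- The path through the upper neighbour carries the sign of its downward edge, minus that of
      -- the upward one; hence the commutator.
      have hs := sgn_symm hΩ ⟨(i, j), hji.symm⟩
      simp only [SimpleGraph.Dart.symm, Prod.swap] at this hs
      simp [this, hs]
  · rw [dif_neg hji, dif_neg (fun h => hji h.1), dif_neg (fun h => hji h.1)]
    simp

theorem commute_raise_lower (hΩ : IsOrientation (dynkinA n) Ω) {x : EE (dynkinA n) v}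
    (hx : ∀ i, moment Ω x i = 0) : Commute (raise Ω x) (lower x) := by
  refine LinearMap.ext fun y => funext fun i => ?_
  have := moment_apply hΩ x i y
  rw [hx, LinearMap.zero_apply, Pi.sub_apply] at this
  exact (sub_eq_zero.1 this.symm)

theorem raise_pow_apply_eq_zero (x : EE (dynkinA n) v) (m : ℕ) (y : Tot v)
    (i : Fin (2 * n - 1)) (hi : (i : ℕ) < m) : (raise Ω x ^ m) y i = 0 := by
  induction m generalizing i with
  | zero => omega
  | succ m ih =>
    rw [pow_succ', Module.End.mul_apply]
    generalize hw : (raise Ω x ^ m) y = w at ih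
    simp only [raise, LinearMap.pi_apply, LinearMap.sum_apply]
    refine Finset.sum_eq_zero fun j _ => ?_
    split_ifs with h
    · have := ih j (by have := h.2; omega)
      simp [this]
    · rfl

theorem lower_pow_apply_eq_zero (x : EE (dynkinA n) v) (m : ℕ) (y : Tot v)
    (i : Fin (2 * n - 1)) (hi : 2 * n - 1 ≤ (i : ℕ) + m) : (lower x ^ m) y i = 0 := by
  induction m generalizing i with
  | zero => omega
  | succ m ih =>
    rw [pow_succ', Module.End.mul_apply]
    generalize hw : (lower x ^ m) y = w at ih
    simp only [lower, LinearMap.pi_apply, LinearMap.sum_apply]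
    refine Finset.sum_eq_zero fun j _ => ?_
    split_ifs with h
    · have := ih j (by have := h.2; omega)
      simp [this]
    · rfl

/-! ### The linear forms t L^s R^r. -/

/-- The linear form on the total space given by `t`. -/
noncomputable def totalForm (t : (i : Fin (2 * n - 1)) → (Sp (v i) →ₗ[ℂ] Sp (eVec n i))) :
    Tot v →ₗ[ℂ] ℂ :=
  ∑ k, ∑ i : Fin (eVec n k), LinearMap.proj i ∘ₗ t k ∘ₗ LinearMap.proj k

theorem totalForm_apply (t : (i : Fin (2 * n - 1)) → (Sp (v i) →ₗ[ℂ] Sp (eVec n i)))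
    (y : Tot v) : totalForm t y = ∑ k, ∑ i, t k (y k) i := by
  simp [totalForm]

theorem eVec_subsingleton (k : Fin (2 * n - 1)) : Subsingleton (Fin (eVec n k)) := by
  unfold eVec; split_ifs <;> infer_instance

theorem eVec_eq {k : Fin (2 * n - 1)} (i : Fin (eVec n k)) : (k : ℕ) + 1 = n := by
  by_contra h
  have := i.2
  simp [eVec, h] at this

theorem totalForm_eq_zero (t : (i : Fin (2 * n - 1)) → (Sp (v i) →ₗ[ℂ] Sp (eVec n i)))
    (y : Tot v) (hy : ∀ k : Fin (2 * n - 1), (k : ℕ) + 1 = n → y k = 0) : totalForm t y = 0 := by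
  rw [totalForm_apply]
  refine Finset.sum_eq_zero fun k _ => Finset.sum_eq_zero fun i _ => ?_
  simp [hy k (eVec_eq i)]

theorem totalForm_single (t : (i : Fin (2 * n - 1)) → (Sp (v i) →ₗ[ℂ] Sp (eVec n i)))
    (k : Fin (2 * n - 1)) (a : Sp (v k)) (i : Fin (eVec n k)) :
    totalForm t (Pi.single k a) = t k a i := by
  have := eVec_subsingleton k
  rw [totalForm_apply, Finset.sum_eq_single k, Pi.single_eq_same, Fintype.sum_subsingleton _ i]
  · intro j _ hj
    simp [Pi.single_eq_of_ne hj]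
  · simp

/-- The linear forms `t ∘ x_left^s ∘ x_up^r` on the total space. -/
noncomputable def cellForm (Ω : Set (dynkinA n).Dart) (z : Pair (dynkinA n) v (eVec n)) (r s : ℕ) :
    Tot v →ₗ[ℂ] ℂ :=
  totalForm z.2 ∘ₗ (lower z.1 ^ s) ∘ₗ (raise Ω z.1 ^ r)

section CellForm

variable {z : Pair (dynkinA n) v (eVec n)}

theorem cellForm_raise (r s : ℕ) (y : Tot v) :
    cellForm Ω z r s (raise Ω z.1 y) = cellForm Ω z (r + 1) s y := by
  simp only [cellForm, LinearMap.comp_apply, pow_succ, Module.End.mul_apply]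

theorem cellForm_zero_lower (s : ℕ) (y : Tot v) :
    cellForm Ω z 0 s (lower z.1 y) = cellForm Ω z 0 (s + 1) y := by
  simp only [cellForm, LinearMap.comp_apply, pow_succ, Module.End.mul_apply, pow_zero,
    Module.End.one_apply]

theorem cellForm_lower (hc : Commute (raise Ω z.1) (lower z.1)) (r s : ℕ) (y : Tot v) :
    cellForm Ω z r s (lower z.1 y) = cellForm Ω z r (s + 1) y := by
  have := LinearMap.congr_fun (hc.pow_left r).eq y
  simp only [Module.End.mul_apply] at this
  simp only [cellForm, LinearMap.comp_apply, pow_succ, Module.End.mul_apply, this]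

/-- The index d stands for the vertex d + 1. After r steps up and s steps down it becomes d + 1 + r
- s, and t only sees the vertex n. -/
theorem cellForm_homog (r s : ℕ) {d : ℤ} {y : Tot v} (hy : IsHomog d y)
    (hd : d + 1 + r ≠ n + s) : cellForm Ω z r s y = 0 := by
  induction r generalizing d y with
  | zero =>
    induction s generalizing d y with
    | zero =>
      refine totalForm_eq_zero _ _ fun k hk => ?_
      refine hy k ?_
      push_cast at hd
      omega
    | succ s ih =>
      rw [← cellForm_zero_lower]
      exact ih hy.lower (by push_cast at hd ⊢; omega)
  | succ r ih =>
    rw [← cellForm_raise]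
    exact ih hy.raise (by push_cast at hd ⊢; omega)

/-- Commutation lets R^r act last; its image lives in indices at least r, while t reads index n - 1.
-/
theorem cellForm_eq_zero_of_le_left (hc : Commute (raise Ω z.1) (lower z.1)) {r s : ℕ}
    (hr : n ≤ r) : cellForm Ω z r s = 0 := by
  refine LinearMap.ext fun y => ?_
  have := LinearMap.congr_fun ((hc.pow_left r).pow_right s).eq y
  simp only [Module.End.mul_apply] at this
  simp only [cellForm, LinearMap.comp_apply, ← this]
  refine totalForm_eq_zero _ _ fun k hk => ?_
  exact raise_pow_apply_eq_zero _ _ _ _ (by omega)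

theorem cellForm_eq_zero_of_le_right {r s : ℕ} (hs : n ≤ s) : cellForm Ω z r s = 0 := by
  refine LinearMap.ext fun y => ?_
  simp only [cellForm, LinearMap.comp_apply]
  refine totalForm_eq_zero _ _ fun k hk => ?_
  exact lower_pow_apply_eq_zero _ _ _ _ (by omega)

/-- Stability: the linear forms separate points. -/
theorem eq_zero_of_cellForm (hc : Commute (raise Ω z.1) (lower z.1)) (hz : IsStab z)
    (k : Fin (2 * n - 1)) (a : Sp (v k)) (ha : ∀ r s, cellForm Ω z r s (Pi.single k a) = 0) :
    a = 0 := by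
  -- The common kernel of all the forms is stable under x, because composing a form with R or L
  -- gives another form; t vanishes on it by the case r = s = 0.
  let S : (i : Fin (2 * n - 1)) → Submodule ℂ (Sp (v i)) := fun i =>
    ⨅ r, ⨅ s, LinearMap.ker (cellForm Ω z r s ∘ₗ LinearMap.single ℂ (fun k => Sp (v k)) i)
  have hS : ∀ i a, a ∈ S i ↔ ∀ r s, cellForm Ω z r s (Pi.single i a) = 0 := by
    intro i a
    simp [S, Submodule.mem_iInf]
  have := hz S ?_ ?_ k
  · have hk : a ∈ S k := (hS k a).2 ha
    rw [this] at hk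
    exact hk
  · intro h a ha
    rw [hS] at ha ⊢
    intro r s
    rcases dart_cases h with hd | hd
    · have h1 := ha (r + 1) s
      rw [← cellForm_raise, raise_single _ h hd, Pi.single_smul, map_smul, smul_eq_mul] at h1
      refine (mul_eq_zero.1 h1).resolve_left fun h0 => ?_
      have := sgn_mul_self Ω h
      simp [h0] at this
    · have h1 := ha r (s + 1)
      rwa [← cellForm_lower hc, lower_single _ h hd] at h1
  · intro i a ha
    funext j
    rw [hS] at ha
    rw [← totalForm_single]
    exact ha 0 0

theorem eq_of_cellForm (hc : Commute (raise Ω z.1) (lower z.1)) (hz : IsStab z)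
    (k : Fin (2 * n - 1)) (a b : Sp (v k))
    (hab : ∀ r s, cellForm Ω z r s (Pi.single k a) = cellForm Ω z r s (Pi.single k b)) :
    a = b := by
  rw [← sub_eq_zero]
  refine eq_zero_of_cellForm hc hz k _ fun r s => ?_
  rw [Pi.single_sub, map_sub, hab, sub_self]

/-- LR preserves the degree and shifts the forms along their diagonal. This is the action of u that
makes the ideal monomial. -/
theorem cellForm_diag (hc : Commute (raise Ω z.1) (lower z.1)) (r s i : ℕ) (y : Tot v) :
    cellForm Ω z r s (((lower z.1 * raise Ω z.1) ^ i) y) = cellForm Ω z (r + i) (s + i) y := by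
  induction i generalizing y with
  | zero => rfl
  | succ i ih =>
    rw [pow_succ, Module.End.mul_apply, ih, Module.End.mul_apply, cellForm_lower hc,
      cellForm_raise]
    rfl

theorem IsHomog.diag {x : EE (dynkinA n) v} {d : ℤ} {y : Tot v} (hy : IsHomog d y) (i : ℕ) :
    IsHomog d (((QuiverVariety.lower x * QuiverVariety.raise Ω x) ^ i) y) := by
  induction i with
  | zero => exact hy
  | succ i ih =>
    rw [pow_succ', Module.End.mul_apply, Module.End.mul_apply]
    have := (ih.raise (Ω := Ω) (x := x)).lower (x := x)
    rwa [add_sub_cancel_right] at this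

theorem IsHomog.eq_single {k : Fin (2 * n - 1)} {y : Tot v} (hy : IsHomog ((k : ℕ) : ℤ) y) :
    y = Pi.single k (y k) := by
  funext i
  by_cases hi : i = k
  · subst hi; simp
  · rw [Pi.single_eq_of_ne hi]
    exact hy i fun h => hi (Fin.ext (by exact_mod_cast h))

theorem cellForm_antitone (hc : Commute (raise Ω z.1) (lower z.1)) {r s r' s' : ℕ}
    (hr : r ≤ r') (hs : s ≤ s') (h : cellForm Ω z r s = 0) : cellForm Ω z r' s' = 0 := by
  have h1 : ∀ i, cellForm Ω z (r + i) s = 0 := by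
    intro i
    induction i with
    | zero => exact h
    | succ i ih =>
      refine LinearMap.ext fun y => ?_
      rw [← add_assoc, ← cellForm_raise, ih]; rfl
  have h2 : ∀ i, cellForm Ω z r' (s + i) = 0 := by
    intro i
    induction i with
    | zero => obtain ⟨j, rfl⟩ := Nat.exists_eq_add_of_le hr; exact h1 j
    | succ i ih =>
      refine LinearMap.ext fun y => ?_
      rw [← add_assoc, ← cellForm_lower hc, ih]; rfl
  obtain ⟨j, rfl⟩ := Nat.exists_eq_add_of_le hs
  exact h2 j

/-! ### The diagram of a point and the dual basis. -/

open Classical in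
/-- The Young diagram of a point: the cells whose linear form does not vanish. -/
noncomputable def diagramOf (hc : Commute (raise Ω z.1) (lower z.1)) : YoungDiagram where
  cells := (Finset.range n ×ˢ Finset.range n).filter fun c => cellForm Ω z c.1 c.2 ≠ 0
  isLowerSet := by
    rintro ⟨r, s⟩ ⟨r', s'⟩ ⟨hr, hs⟩ h
    simp only [Finset.coe_filter, Finset.mem_product, Finset.mem_range, Set.mem_ofPred_eq] at h hr hs ⊢
    exact ⟨⟨hr.trans_lt h.1.1, hs.trans_lt h.1.2⟩, fun h0 => h.2 (cellForm_antitone hc hr hs h0)⟩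

theorem mem_diagramOf (hc : Commute (raise Ω z.1) (lower z.1)) (c : ℕ × ℕ) :
    c ∈ diagramOf hc ↔ cellForm Ω z c.1 c.2 ≠ 0 := by
  rw [← YoungDiagram.mem_cells]
  simp only [diagramOf, Finset.mem_filter, Finset.mem_product, Finset.mem_range,
    and_iff_right_iff_imp]
  intro h
  constructor
  · by_contra h'
    exact h (cellForm_eq_zero_of_le_left hc (not_lt.1 h'))
  · by_contra h'
    exact h (cellForm_eq_zero_of_le_right (not_lt.1 h'))

theorem diagramOf_mem_boxDiagrams (hc : Commute (raise Ω z.1) (lower z.1)) :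
    diagramOf hc ∈ boxDiagrams n := by
  intro c hmem
  rw [← YoungDiagram.mem_cells] at hmem
  simp only [diagramOf, Finset.mem_filter, Finset.mem_product, Finset.mem_range] at hmem
  exact hmem.1

theorem mem_cellsOfDegree {Y : YoungDiagram} {k : Fin (2 * n - 1)} {c : ℕ × ℕ} :
    c ∈ cellsOfDegree n Y k ↔ c ∈ Y ∧ n + c.2 = (k : ℕ) + 1 + c.1 := by
  simp [cellsOfDegree]

/-- The values of the linear forms on `V_k`. -/
noncomputable def cellCoords (hc : Commute (raise Ω z.1) (lower z.1)) (k : Fin (2 * n - 1)) :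
    Sp (v k) →ₗ[ℂ] (cellsOfDegree n (diagramOf hc) k → ℂ) :=
  LinearMap.pi fun c => cellForm Ω z c.1.1 c.1.2 ∘ₗ LinearMap.single ℂ (fun k => Sp (v k)) k

theorem cellCoords_apply (hc : Commute (raise Ω z.1) (lower z.1)) (k : Fin (2 * n - 1))
    (a : Sp (v k)) (c : cellsOfDegree n (diagramOf hc) k) :
    cellCoords hc k a c = cellForm Ω z c.1.1 c.1.2 (Pi.single k a) := rfl

theorem cellCoords_injective (hc : Commute (raise Ω z.1) (lower z.1)) (hz : IsStab z)
    (k : Fin (2 * n - 1)) : Function.Injective (cellCoords hc k) := by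
  refine (injective_iff_map_eq_zero _).2 fun a ha => ?_
  refine eq_zero_of_cellForm hc hz k a fun r s => ?_
  by_cases hd : ((k : ℕ) : ℤ) + 1 + r = n + s
  · by_cases h0 : cellForm Ω z r s = 0
    · rw [h0]; rfl
    · have hmem : (r, s) ∈ cellsOfDegree n (diagramOf hc) k :=
        mem_cellsOfDegree.2 ⟨(mem_diagramOf hc _).2 h0, by simp only; omega⟩
      exact congrFun ha ⟨_, hmem⟩
  · exact cellForm_homog r s (isHomog_single k a) hd

/-- Equivalently, the nonzero forms of one degree, which lie on one diagonal, are linearly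
independent. In a relation let c be the topmost cell with nonzero coefficient and c + (i, i) the
last cell of its diagonal with nonzero form. Composing with (LR)^i kills the terms below c, so the
form at c + (i, i) would vanish. -/
theorem cellCoords_surjective (hc : Commute (raise Ω z.1) (lower z.1))
    (k : Fin (2 * n - 1)) : Function.Surjective (cellCoords hc k) := by
  classical
  -- A functional g killing the range is a relation among the forms, with coefficients g (Pi.single
  -- c 1).
  rw [← LinearMap.dualMap_injective_iff]
  refine (injective_iff_map_eq_zero _).2 fun g hg => ?_
  by_contra hne
  have hsum : ∀ u, g u = ∑ c, u c * g (Pi.single c 1) := by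
    intro u
    conv_lhs => rw [LinearMap.pi_apply_eq_sum_univ g u]
    simp only [smul_eq_mul]
    refine Finset.sum_congr rfl fun c _ => ?_
    congr 2
    funext d
    simp [Pi.single_apply, eq_comm]
  have hex : ∃ m, ∃ c, c.1.1 = m ∧ g (Pi.single c 1) ≠ 0 := by
    by_contra! h
    exact hne (LinearMap.ext fun u => by
      rw [hsum]
      exact Finset.sum_eq_zero fun c _ => by rw [h _ c rfl, mul_zero])
  obtain ⟨c, hcm, hc0⟩ := Nat.find_spec hex
  have hmin : ∀ d, d.1.1 < c.1.1 → g (Pi.single d 1) = 0 := by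
    intro d hd
    by_contra h
    exact Nat.find_min hex (hcm ▸ hd) ⟨d, rfl, h⟩
  -- The first offset with zero form is positive, since c is a cell; its predecessor is the i used
  -- below.
  have hex2 : ∃ i, cellForm Ω z (c.1.1 + i) (c.1.2 + i) = 0 :=
    ⟨n, cellForm_eq_zero_of_le_left hc (by omega)⟩
  have hcY := mem_cellsOfDegree.1 c.2
  obtain ⟨i, hi⟩ : ∃ i, Nat.find hex2 = i + 1 := by
    refine Nat.exists_eq_succ_of_ne_zero fun h0 => ?_
    have := Nat.find_spec hex2
    rw [h0] at this
    exact (mem_diagramOf hc _).1 hcY.1 this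
  have hlast := Nat.find_spec hex2
  rw [hi] at hlast
  refine Nat.find_min hex2 (m := i) (by omega) (LinearMap.ext fun y => ?_)
  have key : ∀ a : Sp (v k), cellForm Ω z (c.1.1 + i) (c.1.2 + i) (Pi.single k a) = 0 := by
    intro a
    have hh := (isHomog_single k a).diag (Ω := Ω) (x := z.1) i
    have h1 := LinearMap.congr_fun hg ((((lower z.1 * raise Ω z.1) ^ i) (Pi.single k a)) k)
    rw [LinearMap.dualMap_apply, hsum, Finset.sum_eq_single c] at h1
    · rw [cellCoords_apply, ← hh.eq_single, cellForm_diag hc] at h1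
      exact (mul_eq_zero.1 h1).resolve_right hc0
    · intro d _ hdc
      rw [cellCoords_apply, ← hh.eq_single, cellForm_diag hc]
      have hdY := mem_cellsOfDegree.1 d.2
      rcases lt_trichotomy d.1.1 c.1.1 with h | h | h
      · rw [hmin d h, mul_zero]
      · exact absurd (Subtype.ext (Prod.ext h (by omega))) hdc
      · rw [cellForm_antitone hc (r := c.1.1 + (i + 1)) (s := c.1.2 + (i + 1)) (by omega)
          (by omega) hlast]
        simp
    · simp
  have hy : y = ∑ j, Pi.single j (y j) := (Finset.univ_sum_single y).symm
  rw [hy, map_sum]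
  refine Finset.sum_eq_zero fun j _ => ?_
  by_cases hj : j = k
  · subst hj; exact key _
  · refine cellForm_homog _ _ (isHomog_single j _) fun h => hj (Fin.ext ?_)
    have := hcY.2
    push_cast at h
    omega

/-- The basis of `V_k` dual to the linear forms. -/
noncomputable def cellBasis (hc : Commute (raise Ω z.1) (lower z.1)) (hz : IsStab z)
    (k : Fin (2 * n - 1)) : Module.Basis (cellsOfDegree n (diagramOf hc) k) ℂ (Sp (v k)) :=
  Module.Basis.ofEquivFun (LinearEquiv.ofBijective (cellCoords hc k)
    ⟨cellCoords_injective hc hz k, cellCoords_surjective hc k⟩)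

theorem cellForm_cellVec (hc : Commute (raise Ω z.1) (lower z.1)) (hz : IsStab z)
    (k : Fin (2 * n - 1)) (c : ℕ × ℕ) (r s : ℕ) :
    cellForm Ω z r s (Pi.single k (cellVec (cellBasis hc hz) k c)) =
      if c ∈ cellsOfDegree n (diagramOf hc) k ∧ c = (r, s) then 1 else 0 := by
  by_cases hmem : c ∈ cellsOfDegree n (diagramOf hc) k
  · rw [cellVec, dif_pos hmem]
    by_cases hrs : (r, s) ∈ cellsOfDegree n (diagramOf hc) k
    · have h1 : cellCoords hc k (cellBasis hc hz k ⟨c, hmem⟩) = Pi.single ⟨c, hmem⟩ 1 := by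
        have := (LinearEquiv.ofBijective (cellCoords hc k)
          ⟨cellCoords_injective hc hz k, cellCoords_surjective hc k⟩).apply_symm_apply
            (Pi.single ⟨c, hmem⟩ 1)
        rw [cellBasis, Module.Basis.coe_ofEquivFun]
        exact this
      have h2 := congrFun h1 ⟨(r, s), hrs⟩
      rw [cellCoords_apply] at h2
      rw [h2, Pi.single_apply]
      simp [hmem, eq_comm]
    · rw [if_neg (by rintro ⟨_, rfl⟩; exact hrs hmem)]
      by_cases h0 : cellForm Ω z r s = 0
      · rw [h0]; rfl
      · refine cellForm_homog _ _ (isHomog_single k _) fun h => hrs ?_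
        exact mem_cellsOfDegree.2 ⟨(mem_diagramOf hc _).2 h0, by simp only; omega⟩
  · rw [cellVec, dif_neg hmem, if_neg (fun h => hmem h.1)]
    simp

/-- Transposition: composition with R takes the form (r, s) to (r + 1, s), so R takes the dual
vector of (r + 1, s) to that of (r, s); likewise for L. Equalities are tested on all forms, which
suffices by stability. -/
theorem isDiagramPoint_cellBasis (hc : Commute (raise Ω z.1) (lower z.1)) (hz : IsStab z) :
    IsDiagramPoint Ω (diagramOf hc) z (cellBasis hc hz) where
  up h hd r s hmem := by
    have hmem' : (r, s) ∈ cellsOfDegree n (diagramOf hc) h.snd := by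
      rw [mem_cellsOfDegree] at hmem ⊢
      exact ⟨(diagramOf hc).up_left_mem (Nat.le_succ r) le_rfl hmem.1, by
        have := hmem.2; simp only at this ⊢; omega⟩
    have : sgn Ω h • z.1 h (cellVec (cellBasis hc hz) h.fst (r + 1, s)) =
        cellVec (cellBasis hc hz) h.snd (r, s) := by
      refine eq_of_cellForm hc hz _ _ _ fun r' s' => ?_
      rw [← raise_single _ h hd, cellForm_raise, cellForm_cellVec, cellForm_cellVec]
      simp [hmem, hmem']
    rw [← this, sgn_smul_smul]
  up_zero h hd s := by
    have : sgn Ω h • z.1 h (cellVec (cellBasis hc hz) h.fst (0, s)) = 0 := by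
      refine eq_of_cellForm hc hz _ _ _ fun r' s' => ?_
      rw [← raise_single _ h hd, cellForm_raise, cellForm_cellVec]
      simp
    rw [← sgn_smul_smul Ω h (z.1 h _), this, smul_zero]
  left h hd r s hmem := by
    have hmem' : (r, s) ∈ cellsOfDegree n (diagramOf hc) h.snd := by
      rw [mem_cellsOfDegree] at hmem ⊢
      exact ⟨(diagramOf hc).up_left_mem le_rfl (Nat.le_succ s) hmem.1, by
        have := hmem.2; simp only at this ⊢; omega⟩
    refine eq_of_cellForm hc hz _ _ _ fun r' s' => ?_
    rw [← lower_single _ h hd, cellForm_lower hc, cellForm_cellVec, cellForm_cellVec]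
    simp [hmem, hmem']
  left_zero h hd r := by
    refine eq_of_cellForm hc hz _ _ _ fun r' s' => ?_
    rw [← lower_single _ h hd, cellForm_lower hc, cellForm_cellVec]
    simp
  corner k hk := by
    funext i
    rw [← totalForm_single]
    have := cellForm_cellVec hc hz k (0, 0) 0 0
    simpa [hk, cellForm] using this
  not_corner k c hc0 := by
    funext i
    rw [← totalForm_single]
    have := cellForm_cellVec hc hz k c 0 0
    simpa [hc0, cellForm] using this

end CellForm

/-- Every point of `Λ(v; e^n)^st` is given by a Young diagram. -/
theorem exists_isDiagramPoint (hΩ : IsOrientation (dynkinA n) Ω)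
    {z : Pair (dynkinA n) v (eVec n)} (hz : z ∈ LambdaSt Ω v (eVec n)) :
    ∃ Y ∈ boxDiagrams n,
      ∃ b : (k : Fin (2 * n - 1)) → Module.Basis (cellsOfDegree n Y k) ℂ (Sp (v k)),
        IsDiagramPoint Ω Y z b := by
  have hc := commute_raise_lower hΩ hz.1.1
  exact ⟨diagramOf hc, diagramOf_mem_boxDiagrams hc, cellBasis hc hz.2,
    isDiagramPoint_cellBasis hc hz.2⟩

/-! ### The dimension vector determines the diagram. -/

theorem eq_dimY {Y : YoungDiagram}
    (b : (k : Fin (2 * n - 1)) → Module.Basis (cellsOfDegree n Y k) ℂ (Sp (v k))) :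
    v = dimY n Y := by
  funext k
  have := Module.finrank_eq_card_basis (b k)
  simpa [dimY] using this

/-- If c lies in Y but not in Y', the cells of Y' on the diagonal of c all precede c, hence lie in
Y; as c itself is missing, Y' has fewer cells there. -/
theorem le_of_dimY_eq {Y Y' : YoungDiagram} (hY : Y ∈ boxDiagrams n)
    (h : dimY n Y = dimY n Y') : Y ≤ Y' := by
  rintro ⟨r, s⟩ hc
  by_contra hc'
  have hb := hY _ hc
  simp only at hb
  let k : Fin (2 * n - 1) := ⟨n + s - r - 1, by omega⟩
  have hk : (k : ℕ) = n + s - r - 1 := rfl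
  have hlt : cellsOfDegree n Y' k ⊂ cellsOfDegree n Y k := by
    rw [Finset.ssubset_iff_of_subset]
    · exact ⟨(r, s), mem_cellsOfDegree.2 ⟨hc, by simp only; omega⟩,
        fun h' => hc' (mem_cellsOfDegree.1 h').1⟩
    · rintro ⟨r', s'⟩ h'
      rw [mem_cellsOfDegree] at h' ⊢
      refine ⟨?_, h'.2⟩
      have h2 := h'.2
      simp only at h2
      by_cases hr : r' ≤ r
      · exact Y.up_left_mem hr (by omega) hc
      · exact absurd (Y'.up_left_mem (by omega) (by omega) h'.1) hc'
  have := Finset.card_lt_card hlt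
  exact this.ne (congrFun h k).symm

theorem dimY_injOn : Set.InjOn (dimY n) (boxDiagrams n) := fun _ hY _ hY' h =>
  le_antisymm (le_of_dimY_eq hY h) (le_of_dimY_eq hY' h.symm)

/-! ### Points given by a diagram: conjugacy, stability, existence. -/

section DiagramPoint

variable {Y : YoungDiagram} {z z' : Pair (dynkinA n) v (eVec n)}
  {b b' : (k : Fin (2 * n - 1)) → Module.Basis (cellsOfDegree n Y k) ℂ (Sp (v k))}

theorem cellVec_of_mem {k : Fin (2 * n - 1)} (c : cellsOfDegree n Y k) :
    cellVec b k c = b k c := by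
  rw [cellVec, dif_pos c.2]

theorem equiv_cellVec (k : Fin (2 * n - 1)) (c : ℕ × ℕ) :
    (b k).equiv (b' k) (Equiv.refl _) (cellVec b k c) = cellVec b' k c := by
  unfold cellVec
  split_ifs with h
  · simp
  · simp

theorem act_eq_of_isDiagramPoint (hz : IsDiagramPoint Ω Y z b) (hz' : IsDiagramPoint Ω Y z' b') :
    act (fun k => (b k).equiv (b' k) (Equiv.refl _)) z = z' := by
  have hsymm : ∀ k c, ((b k).equiv (b' k) (Equiv.refl _)).symm (cellVec b' k c) =
      cellVec b k c := by
    intro k c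
    rw [LinearEquiv.symm_apply_eq, equiv_cellVec]
  refine Prod.ext (funext fun h => (b' h.fst).ext fun c => ?_)
    (funext fun k => (b' k).ext fun c => ?_)
  · rw [← cellVec_of_mem]
    simp only [act, LinearMap.comp_apply, LinearEquiv.coe_coe, hsymm]
    obtain ⟨⟨r, s⟩, hc⟩ := c
    simp only
    rcases dart_cases h with hd | hd
    · cases r with
      | zero => rw [hz.up_zero h hd, hz'.up_zero h hd, map_zero]
      | succ r => rw [hz.up h hd r s hc, hz'.up h hd r s hc, map_smul, equiv_cellVec]
    · cases s with
      | zero => rw [hz.left_zero h hd, hz'.left_zero h hd, map_zero]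
      | succ s => rw [hz.left h hd r s hc, hz'.left h hd r s hc, equiv_cellVec]
  · rw [← cellVec_of_mem]
    simp only [act, LinearMap.comp_apply, LinearEquiv.coe_coe, hsymm]
    by_cases h0 : (c : ℕ × ℕ) = (0, 0)
    · have hc := c.2
      rw [h0] at hc ⊢
      rw [hz.corner k hc, hz'.corner k hc]
    · rw [hz.not_corner k _ h0, hz'.not_corner k _ h0]

/-- The basis vector `b_c`, as an element of the total space. -/
noncomputable def cellTot
    (b : (k : Fin (2 * n - 1)) → Module.Basis (cellsOfDegree n Y k) ℂ (Sp (v k)))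
    (c : ℕ × ℕ) : Tot v := fun k => cellVec b k c

theorem cellTot_eq_single {k : Fin (2 * n - 1)} (c : cellsOfDegree n Y k) :
    cellTot b c = Pi.single k (b k c) := by
  funext i
  by_cases hi : i = k
  · subst hi
    rw [Pi.single_eq_same, cellTot, cellVec_of_mem]
  · rw [Pi.single_eq_of_ne hi, cellTot, cellVec, dif_neg]
    intro h
    have h1 := (mem_cellsOfDegree.1 h).2
    have h2 := (mem_cellsOfDegree.1 c.2).2
    exact hi (Fin.ext (by omega))

theorem exists_degree (hY : Y ∈ boxDiagrams n) {c : ℕ × ℕ} (hc : c ∈ Y) :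
    ∃ k : Fin (2 * n - 1), c ∈ cellsOfDegree n Y k := by
  have := hY c hc
  exact ⟨⟨n + c.2 - c.1 - 1, by omega⟩, mem_cellsOfDegree.2 ⟨hc, by simp only; omega⟩⟩

theorem IsDiagramPoint.raise_cellTot (hz : IsDiagramPoint Ω Y z b) (hY : Y ∈ boxDiagrams n)
    {r s : ℕ} (hc : (r + 1, s) ∈ Y) : raise Ω z.1 (cellTot b (r + 1, s)) = cellTot b (r, s) := by
  obtain ⟨k, hk⟩ := exists_degree hY hc
  have hc' : (r, s) ∈ Y := Y.up_left_mem (Nat.le_succ r) le_rfl hc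
  obtain ⟨k', hk'⟩ := exists_degree hY hc'
  have h1 := (mem_cellsOfDegree.1 hk).2
  have h2 := (mem_cellsOfDegree.1 hk').2
  simp only at h1 h2
  have hadj : (dynkinA n).Adj k k' := SimpleGraph.pathGraph_adj.2 (by omega)
  have hd : ((⟨(k, k'), hadj⟩ : (dynkinA n).Dart).snd : ℕ) =
    (⟨(k, k'), hadj⟩ : (dynkinA n).Dart).fst + 1 := by simp only; omega
  have e1 := cellTot_eq_single (b := b) ⟨_, hk⟩
  have e2 := cellTot_eq_single (b := b) ⟨_, hk'⟩
  have h3 := hz.up _ hd r s hk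
  rw [cellVec, dif_pos hk, cellVec, dif_pos hk'] at h3
  rw [e1, e2]
  refine (raise_single z.1 _ hd _).trans ?_
  rw [h3, sgn_smul_smul]

theorem IsDiagramPoint.raise_cellTot_zero (hz : IsDiagramPoint Ω Y z b) (s : ℕ) :
    raise Ω z.1 (cellTot b (0, s)) = 0 := by
  funext i
  -- No upward edge ends at the first vertex, so it is treated apart.
  by_cases hi : (i : ℕ) = 0
  · have := raise_pow_apply_eq_zero (Ω := Ω) z.1 1 (cellTot b (0, s)) i (by omega)
    simpa using this
  · have hadj : (dynkinA n).Adj ⟨i - 1, by omega⟩ i :=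
      SimpleGraph.pathGraph_adj.2 (by simp only; omega)
    have hd : ((⟨(⟨i - 1, by omega⟩, i), hadj⟩ : (dynkinA n).Dart).snd : ℕ) =
      (⟨(⟨i - 1, by omega⟩, i), hadj⟩ : (dynkinA n).Dart).fst + 1 := by simp only; omega
    refine (raise_apply z.1 _ hd _).trans ?_
    rw [cellTot, hz.up_zero _ hd, smul_zero]
    rfl

theorem IsDiagramPoint.lower_cellTot (hz : IsDiagramPoint Ω Y z b) (hY : Y ∈ boxDiagrams n)
    {r s : ℕ} (hc : (r, s + 1) ∈ Y) : lower z.1 (cellTot b (r, s + 1)) = cellTot b (r, s) := by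
  obtain ⟨k, hk⟩ := exists_degree hY hc
  have hc' : (r, s) ∈ Y := Y.up_left_mem le_rfl (Nat.le_succ s) hc
  obtain ⟨k', hk'⟩ := exists_degree hY hc'
  have h1 := (mem_cellsOfDegree.1 hk).2
  have h2 := (mem_cellsOfDegree.1 hk').2
  simp only at h1 h2
  have hadj : (dynkinA n).Adj k k' := SimpleGraph.pathGraph_adj.2 (by omega)
  have hd : ((⟨(k, k'), hadj⟩ : (dynkinA n).Dart).fst : ℕ) =
    (⟨(k, k'), hadj⟩ : (dynkinA n).Dart).snd + 1 := by simp only; omega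
  have e1 := cellTot_eq_single (b := b) ⟨_, hk⟩
  have e2 := cellTot_eq_single (b := b) ⟨_, hk'⟩
  have h3 := hz.left _ hd r s hk
  rw [cellVec, dif_pos hk, cellVec, dif_pos hk'] at h3
  rw [e1, e2]
  refine (lower_single z.1 _ hd _).trans ?_
  rw [h3]

theorem IsDiagramPoint.lower_cellTot_zero (hz : IsDiagramPoint Ω Y z b) (r : ℕ) :
    lower z.1 (cellTot b (r, 0)) = 0 := by
  funext i
  by_cases hi : 2 * n - 1 ≤ (i : ℕ) + 1
  · have := lower_pow_apply_eq_zero z.1 1 (cellTot b (r, 0)) i hi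
    simpa using this
  · have hadj : (dynkinA n).Adj ⟨i + 1, by omega⟩ i :=
      SimpleGraph.pathGraph_adj.2 (Or.inr rfl)
    have hd : ((⟨(⟨i + 1, by omega⟩, i), hadj⟩ : (dynkinA n).Dart).fst : ℕ) =
      (⟨(⟨i + 1, by omega⟩, i), hadj⟩ : (dynkinA n).Dart).snd + 1 := rfl
    refine (lower_apply z.1 _ hd _).trans ?_
    rw [cellTot, hz.left_zero _ hd]
    rfl

theorem IsDiagramPoint.moment_eq_zero (hΩ : IsOrientation (dynkinA n) Ω)
    (hz : IsDiagramPoint Ω Y z b) (hY : Y ∈ boxDiagrams n) (i : Fin (2 * n - 1)) :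
    moment Ω z.1 i = 0 := by
  refine (b i).ext fun c => ?_
  rw [← cellVec_of_mem, LinearMap.zero_apply]
  refine (moment_apply hΩ z.1 i (cellTot b c)).trans ?_
  have hc := (mem_cellsOfDegree.1 c.2).1
  generalize (c : ℕ × ℕ) = c at hc
  obtain ⟨r, s⟩ := c
  suffices raise Ω z.1 (lower z.1 (cellTot b (r, s))) =
      lower z.1 (raise Ω z.1 (cellTot b (r, s))) by rw [this, sub_self, Pi.zero_apply]
  rcases r with _ | r <;> rcases s with _ | s
  · rw [hz.lower_cellTot_zero, hz.raise_cellTot_zero, map_zero, map_zero]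
  · rw [hz.lower_cellTot hY hc, hz.raise_cellTot_zero, hz.raise_cellTot_zero, map_zero]
  · rw [hz.lower_cellTot_zero, hz.raise_cellTot hY hc, hz.lower_cellTot_zero, map_zero]
  · rw [hz.lower_cellTot hY hc, hz.raise_cellTot hY hc,
      hz.raise_cellTot hY (Y.up_left_mem le_rfl (Nat.le_succ s) hc),
      hz.lower_cellTot hY (Y.up_left_mem (Nat.le_succ r) le_rfl hc)]

/-- Every edge either kills a basis vector or decreases r + s by one, up to sign. -/
theorem IsDiagramPoint.walkMap_cellVec (hz : IsDiagramPoint Ω Y z b)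
    {i j : Fin (2 * n - 1)} (p : (dynkinA n).Walk i j) (r s : ℕ) (h : r + s < p.length) :
    walkMap z.1 p (cellVec b i (r, s)) = 0 := by
  induction p generalizing r s with
  | nil => simp at h
  | @cons i k j hik p ih =>
    rw [SimpleGraph.Walk.length_cons] at h
    rw [walkMap, LinearMap.comp_apply]
    by_cases hc : (r, s) ∈ cellsOfDegree n Y i
    · rcases dart_cases ⟨(i, k), hik⟩ with hd | hd
      · cases r with
        | zero => rw [hz.up_zero _ hd, map_zero]
        | succ r => rw [hz.up _ hd r s hc, map_smul, ih _ _ (by omega), smul_zero]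
      · cases s with
        | zero => rw [hz.left_zero _ hd, map_zero]
        | succ s => rw [hz.left _ hd r s hc, ih _ _ (by omega)]
    · rw [cellVec, dif_neg hc, map_zero, map_zero]

theorem IsDiagramPoint.isNilp (hn : 1 ≤ n) (hz : IsDiagramPoint Ω Y z b)
    (hY : Y ∈ boxDiagrams n) : IsNilp z.1 := by
  -- In the box r + s ≤ 2n - 2, so 2n steps are enough.
  refine ⟨2 * n, by omega, fun i j p hp => (b i).ext fun c => ?_⟩
  rw [← cellVec_of_mem, LinearMap.zero_apply]
  obtain ⟨⟨r, s⟩, hc⟩ := c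
  have := hY _ (mem_cellsOfDegree.1 hc).1
  simp only at this
  exact hz.walkMap_cellVec p _ _ (by omega)

theorem IsDiagramPoint.cellForm_cellTot (hz : IsDiagramPoint Ω Y z b) (hY : Y ∈ boxDiagrams n)
    (r s : ℕ) {c : ℕ × ℕ} (hc : c ∈ Y) :
    cellForm Ω z r s (cellTot b c) = if c = (r, s) then 1 else 0 := by
  induction r generalizing c with
  | zero =>
    induction s generalizing c with
    | zero =>
      change totalForm z.2 (cellTot b c) = _
      split_ifs with h0
      · subst h0
        have hn := (hY _ hc).1
        simp only at hn
        let k : Fin (2 * n - 1) := ⟨n - 1, by omega⟩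
        have hkn : (k : ℕ) + 1 = n := by simp only [k]; omega
        have hk : (0, 0) ∈ cellsOfDegree n Y k :=
          mem_cellsOfDegree.2 ⟨hc, by simp only; omega⟩
        have e := cellTot_eq_single (b := b) ⟨_, hk⟩
        have hcor := hz.corner k hk
        rw [cellVec, dif_pos hk] at hcor
        rw [e, totalForm_single z.2 k _ ⟨0, by simp [eVec, hkn]⟩, hcor]
      · rw [totalForm_apply]
        refine Finset.sum_eq_zero fun k _ => Finset.sum_eq_zero fun i _ => ?_
        rw [cellTot, hz.not_corner k c h0]
        rfl
    | succ s ih =>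
      rw [← cellForm_zero_lower]
      obtain ⟨r', s'⟩ := c
      cases s' with
      | zero => rw [hz.lower_cellTot_zero]; simp
      | succ s' =>
        rw [hz.lower_cellTot hY hc, ih (Y.up_left_mem le_rfl (Nat.le_succ s') hc)]
        simp
  | succ r ih =>
    rw [← cellForm_raise]
    obtain ⟨r', s'⟩ := c
    cases r' with
    | zero => rw [hz.raise_cellTot_zero]; simp
    | succ r' =>
      rw [hz.raise_cellTot hY hc, ih (Y.up_left_mem (Nat.le_succ r') le_rfl hc)]
      simp

/-- By induction on r and s all forms vanish on a stable S killed by t; but they include the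
coordinates in the basis b. -/
theorem IsDiagramPoint.isStab (hz : IsDiagramPoint Ω Y z b) (hY : Y ∈ boxDiagrams n) :
    IsStab z := by
  intro S hx ht i
  rw [Submodule.eq_bot_iff]
  have hraise : ∀ y : Tot v, (∀ k, y k ∈ S k) → ∀ k, raise Ω z.1 y k ∈ S k := by
    intro y hy k
    simp only [raise, LinearMap.pi_apply, LinearMap.sum_apply]
    refine Submodule.sum_mem _ fun j _ => ?_
    split_ifs with h
    · exact (S k).smul_mem _ (hx ⟨(j, k), h.1⟩ _ (hy j))
    · exact (S k).zero_mem
  have hlower : ∀ y : Tot v, (∀ k, y k ∈ S k) → ∀ k, lower z.1 y k ∈ S k := by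
    intro y hy k
    simp only [lower, LinearMap.pi_apply, LinearMap.sum_apply]
    refine Submodule.sum_mem _ fun j _ => ?_
    split_ifs with h
    · exact hx ⟨(j, k), h.1⟩ _ (hy j)
    · exact (S k).zero_mem
  have hform : ∀ r s, ∀ y : Tot v, (∀ k, y k ∈ S k) → cellForm Ω z r s y = 0 := by
    intro r
    induction r with
    | zero =>
      intro s
      induction s with
      | zero =>
        intro y hy
        change totalForm z.2 y = 0
        rw [totalForm_apply]
        refine Finset.sum_eq_zero fun k _ => Finset.sum_eq_zero fun j _ => ?_
        rw [ht k _ (hy k)]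
        rfl
      | succ s ih => intro y hy; rw [← cellForm_zero_lower]; exact ih _ (hlower y hy)
    | succ r ih => intro s y hy; rw [← cellForm_raise]; exact ih s _ (hraise y hy)
  intro a ha
  refine (b i).ext_elem fun c => ?_
  have hcoord : cellForm Ω z c.1.1 c.1.2 ∘ₗ LinearMap.single ℂ (fun k => Sp (v k)) i =
      (b i).coord c := by
    refine (b i).ext fun d => ?_
    rw [LinearMap.comp_apply, LinearMap.coe_single, ← cellTot_eq_single,
      hz.cellForm_cellTot hY _ _ (mem_cellsOfDegree.1 d.2).1, Module.Basis.coord_apply,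
      Module.Basis.repr_self, Finsupp.single_apply]
    simp
  have h1 := LinearMap.congr_fun hcoord a
  rw [LinearMap.comp_apply, LinearMap.coe_single, Module.Basis.coord_apply, hform] at h1
  · rw [← h1]; simp
  · intro k
    by_cases hk : k = i
    · subst hk; simpa using ha
    · rw [Pi.single_eq_of_ne hk]; exact (S k).zero_mem

theorem IsDiagramPoint.mem_lambdaSt (hn : 1 ≤ n) (hΩ : IsOrientation (dynkinA n) Ω)
    (hz : IsDiagramPoint Ω Y z b) (hY : Y ∈ boxDiagrams n) : z ∈ LambdaSt Ω v (eVec n) :=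
  ⟨⟨hz.moment_eq_zero hΩ hY, hz.isNilp hn hY⟩, hz.isStab hY⟩

/-- The point `(x, t)` given by a Young diagram and a basis indexed by its cells. -/
noncomputable def diagramPoint (Ω : Set (dynkinA n).Dart)
    (b : (k : Fin (2 * n - 1)) → Module.Basis (cellsOfDegree n Y k) ℂ (Sp (v k))) :
    Pair (dynkinA n) v (eVec n) :=
  (fun h => (b h.fst).constr ℂ fun c =>
      if (h.snd : ℕ) = h.fst + 1 then
        if c.1.1 = 0 then 0 else sgn Ω h • cellVec b h.snd (c.1.1 - 1, c.1.2)
      else if c.1.2 = 0 then 0 else cellVec b h.snd (c.1.1, c.1.2 - 1),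
    fun k => (b k).constr ℂ fun c => if c.1 = (0, 0) then fun _ => 1 else 0)

theorem isDiagramPoint_diagramPoint (Ω : Set (dynkinA n).Dart)
    (b : (k : Fin (2 * n - 1)) → Module.Basis (cellsOfDegree n Y k) ℂ (Sp (v k))) :
    IsDiagramPoint Ω Y (diagramPoint Ω b) b where
  up h hd r s hmem := by
    rw [cellVec, dif_pos hmem]
    refine ((b _).constr_basis ℂ _ _).trans ?_
    simp [hd]
  up_zero h hd s := by
    by_cases hmem : (0, s) ∈ cellsOfDegree n Y h.fst
    · rw [cellVec, dif_pos hmem]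
      refine ((b _).constr_basis ℂ _ _).trans ?_
      simp [hd]
    · rw [cellVec, dif_neg hmem, map_zero]
  left h hd r s hmem := by
    rw [cellVec, dif_pos hmem]
    have : ¬ (h.snd : ℕ) = h.fst + 1 := by omega
    refine ((b _).constr_basis ℂ _ _).trans ?_
    simp [this]
  left_zero h hd r := by
    by_cases hmem : (r, 0) ∈ cellsOfDegree n Y h.fst
    · rw [cellVec, dif_pos hmem]
      have : ¬ (h.snd : ℕ) = h.fst + 1 := by omega
      refine ((b _).constr_basis ℂ _ _).trans ?_
      simp [this]
    · rw [cellVec, dif_neg hmem, map_zero]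
  corner k hk := by
    rw [cellVec, dif_pos hk]
    refine ((b _).constr_basis ℂ _ _).trans ?_
    simp
  not_corner k c hc := by
    by_cases hmem : c ∈ cellsOfDegree n Y k
    · rw [cellVec, dif_pos hmem]
      refine ((b _).constr_basis ℂ _ _).trans ?_
      simp [hc]
    · rw [cellVec, dif_neg hmem, map_zero]

end DiagramPoint

/-! ### Quotients with at most one point and their components. -/

theorem XX_nonempty (hn : 1 ≤ n) (hΩ : IsOrientation (dynkinA n) Ω) {Y : YoungDiagram}
    (hY : Y ∈ boxDiagrams n) : (XX Ω Y).Nonempty := by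
  let b : (k : Fin (2 * n - 1)) → Module.Basis (cellsOfDegree n Y k) ℂ (Sp (dimY n Y k)) :=
    fun k => (Pi.basisFun ℂ (Fin (cellsOfDegree n Y k).card)).reindex
      (cellsOfDegree n Y k).equivFin.symm
  have hz := isDiagramPoint_diagramPoint Ω b
  exact ⟨_, ⟨_, hz.mem_lambdaSt hn hΩ hY⟩, rfl, b, hz⟩

/-- `𝓛(v, e^n)` has at most one point. -/
theorem subsingleton_LL (hΩ : IsOrientation (dynkinA n) Ω) (v : Fin (2 * n - 1) → ℕ) :
    Subsingleton (LL Ω v (eVec n)) := by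
  refine ⟨fun p q => ?_⟩
  induction p using Quotient.inductionOn with | _ z
  induction q using Quotient.inductionOn with | _ z'
  obtain ⟨Y, hY, b, hz⟩ := exists_isDiagramPoint hΩ z.2
  obtain ⟨Y', hY', b', hz'⟩ := exists_isDiagramPoint hΩ z'.2
  obtain rfl : Y = Y' := dimY_injOn hY hY' ((eq_dimY b).symm.trans (eq_dimY b'))
  exact Quotient.sound ⟨_, act_eq_of_isDiagramPoint hz hz'⟩

/-- The only topological input: on such a space the topology plays no role. -/
theorem mem_irreducibleComponents_iff_of_subsingleton {X : Type*} [TopologicalSpace X]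
    [Subsingleton X] {S : Set X} : S ∈ irreducibleComponents X ↔ S.Nonempty := by
  refine ⟨fun h => h.1.1, fun h => ⟨⟨h, ?_⟩, fun T _ _ => ?_⟩⟩
  · exact Set.subsingleton_of_subsingleton.isPreirreducible
  · obtain ⟨a, ha⟩ := h
    exact fun c _ => Subsingleton.elim a c ▸ ha

end QuiverVariety

theorem mainTheorem9 (n : ℕ) (hn : 1 ≤ n)
    (Ω : Set (QuiverVariety.dynkinA n).Dart)
    (hΩ : QuiverVariety.IsOrientation (QuiverVariety.dynkinA n) Ω) :
    Set.BijOn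
      (fun Y : YoungDiagram =>
        (⟨QuiverVariety.dimY n Y, QuiverVariety.XX Ω Y⟩ :
          Σ v : Fin (2 * n - 1) → ℕ, Set (QuiverVariety.LL Ω v (QuiverVariety.eVec n))))
      (QuiverVariety.boxDiagrams n)
      (QuiverVariety.BB Ω (QuiverVariety.eVec n)) ∧
    ∀ p ∈ QuiverVariety.BB Ω (QuiverVariety.eVec n),
      ∃ a : QuiverVariety.LL Ω p.1 (QuiverVariety.eVec n), p.2 = {a} := by
  have hsub := QuiverVariety.subsingleton_LL hΩ
  refine ⟨⟨fun Y hY => ?_, fun Y hY Y' hY' h => ?_, ?_⟩, ?_⟩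
  · exact QuiverVariety.mem_irreducibleComponents_iff_of_subsingleton.2
      (QuiverVariety.XX_nonempty hn hΩ hY)
  · exact QuiverVariety.dimY_injOn hY hY' (congrArg Sigma.fst h)
  · rintro ⟨v, S⟩ hS
    obtain ⟨p, hp⟩ := QuiverVariety.mem_irreducibleComponents_iff_of_subsingleton.1 hS
    obtain ⟨z, rfl⟩ := Quotient.exists_rep p
    obtain ⟨Y, hY, b, hz⟩ := QuiverVariety.exists_isDiagramPoint hΩ z.2
    -- Substituting v first puts both components in the same quotient, so that the heterogeneous
    -- equality becomes an ordinary one.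
    obtain rfl := QuiverVariety.eq_dimY b
    refine ⟨Y, hY, Sigma.ext rfl (heq_of_eq ?_)⟩
    have hX : (QuiverVariety.XX Ω Y).Nonempty := ⟨_, z, rfl, b, hz⟩
    exact (Subsingleton.eq_univ_of_nonempty hX).trans
      (Subsingleton.eq_univ_of_nonempty ⟨_, hp⟩).symm
  · rintro ⟨v, S⟩ hS
    obtain ⟨p, hp⟩ := QuiverVariety.mem_irreducibleComponents_iff_of_subsingleton.1 hS
    exact ⟨p, Set.Subsingleton.eq_singleton_of_mem Set.subsingleton_of_subsingleton hp⟩
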